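/- Let $d\ge 1$ and $k\ge 0$ be integers. A set $S\subseteq\mathbb{R}^d$ is generic if no $d+1$ of its points lie on a common hyperplane and no $d+2$ of its points lie on a common $(d-1)$-sphere; a point $x\notin S$ is generic with respect to $S$ if $S\cup\{x\}$ is generic. Let $A\subseteq\mathbb{R}^d$ be finite and generic. A $d$-simplex with vertices in $A$ is $k$-hefty if exactly $k$ points of $A$ lie inside its circumscribed sphere (in the open ball that the sphere bounds). The $k$-hull of $A$, denoted $\mathrm{Hull}_k(A)$, is the intersection of all closed half-spaces that miss at most $k$ of the points of $A$. Then the following hold. (1) Every $x\in\mathbb{R}^d$ that is generic with respect to $A$ is covered by (contained in) at most $\binom{d+k}{d}$ $k$-hefty simplices of $A$. If $A$ has at least $d$ points, then equality holds if and only if $x\in\mathrm{Hull}_k(A)$. (2) For every $a\in A$ there is an $\varepsilon>0$ such that every $x\in\mathbb{R}^d$ with $\|x-a\|<\varepsilon$ that is generic with respect to $A$ is covered by at most $\binom{d+k-1}{d-1}$ $k$-hefty simplices of $A$ incident to $a$ (having $a$ as a vertex). -/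

import Mathlib

open scoped RealInnerProductSpace

/-- A set of points in `ℝ^d` is generic if no `d + 1` of its points lie on a common hyperplane and
no `d + 2` of its points lie on a common `(d - 1)`-sphere. -/
def IsGeneric {d : ℕ} (A : Set (EuclideanSpace ℝ (Fin d))) : Prop :=
  (∀ T : Finset (EuclideanSpace ℝ (Fin d)), (T : Set (EuclideanSpace ℝ (Fin d))) ⊆ A →
    T.card = d + 1 →
      ¬ ∃ (u : EuclideanSpace ℝ (Fin d)) (t : ℝ), u ≠ 0 ∧ ∀ p ∈ T, ⟪u, p⟫ = t) ∧
  (∀ T : Finset (EuclideanSpace ℝ (Fin d)), (T : Set (EuclideanSpace ℝ (Fin d))) ⊆ A →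
    T.card = d + 2 →
      ¬ ∃ (c : EuclideanSpace ℝ (Fin d)) (r : ℝ), 0 < r ∧ ∀ p ∈ T, p ∈ Metric.sphere c r)

/-- A point `x ∉ A` is generic with respect to `A` if `A ∪ {x}` is generic. -/
def IsGenericWrt {d : ℕ} (A : Set (EuclideanSpace ℝ (Fin d))) (x : EuclideanSpace ℝ (Fin d)) :
    Prop :=
  x ∉ A ∧ IsGeneric (A ∪ {x})

open Classical in
/-- The `k`-hefty simplices of a finite (generic) set `A`, each given by its set of `d + 1` vertices
in `A`: exactly `k` points of `A` lie inside the circumscribed sphere. (For generic `A` every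
`d + 1` points of `A` lie on exactly one sphere, so `c` and `r` below are its centre and radius.) -/
noncomputable def heftySimplices {d : ℕ} (A : Finset (EuclideanSpace ℝ (Fin d))) (k : ℕ) :
    Finset (Finset (EuclideanSpace ℝ (Fin d))) :=
  {T ∈ A.powersetCard (d + 1) | ∃ (c : EuclideanSpace ℝ (Fin d)) (r : ℝ), 0 < r ∧
    (∀ p ∈ T, p ∈ Metric.sphere c r) ∧ (A.filter fun p => p ∈ Metric.ball c r).card = k}

open Classical in
/-- The number of `k`-hefty simplices of `A` that cover (contain) the point `x`. -/
noncomputable def coverNumber {d : ℕ} (A : Finset (EuclideanSpace ℝ (Fin d))) (k : ℕ)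
    (x : EuclideanSpace ℝ (Fin d)) : ℕ :=
  ((heftySimplices A k).filter fun T =>
    x ∈ convexHull ℝ (T : Set (EuclideanSpace ℝ (Fin d)))).card

open Classical in
/-- The number of `k`-hefty simplices of `A` incident to `a` (having `a` as a vertex) that cover
the point `x`. -/
noncomputable def incidentCoverNumber {d : ℕ} (A : Finset (EuclideanSpace ℝ (Fin d))) (k : ℕ)
    (a x : EuclideanSpace ℝ (Fin d)) : ℕ :=
  ((heftySimplices A k).filter fun T =>
    a ∈ T ∧ x ∈ convexHull ℝ (T : Set (EuclideanSpace ℝ (Fin d)))).card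

/-- The closed half-space `{y | ⟪u, y⟫ ≤ t}` (for `u ≠ 0`). -/
def closedHalfSpace {d : ℕ} (u : EuclideanSpace ℝ (Fin d)) (t : ℝ) :
    Set (EuclideanSpace ℝ (Fin d)) :=
  {y | ⟪u, y⟫ ≤ t}

open Classical in
/-- The `k`-hull of `A`: the common intersection of all closed half-spaces that miss at most `k` of
the points in `A`. -/
def kHull {d : ℕ} (k : ℕ) (A : Finset (EuclideanSpace ℝ (Fin d))) :
    Set (EuclideanSpace ℝ (Fin d)) :=
  {x | ∀ (u : EuclideanSpace ℝ (Fin d)) (t : ℝ), u ≠ 0 →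
    (A.filter fun p => p ∉ closedHalfSpace u t).card ≤ k → x ∈ closedHalfSpace u t}

/-! Lift the points to vectors `v p` with heights `w p` so that a sphere becomes a linear form `g`
and "inside the sphere" becomes `w p < g (v p)`. For (1) take `v p = (p, 1)` and `w p = ‖p‖ ^ 2 +
1`, in dimension `d + 1`; for (2) take `v p = p - a` and `w p = ‖p - a‖ ^ 2`, in dimension `d`,
which sees exactly the spheres through `a`. Covering `x` becomes (for (2), implies) that a cone
contains the lift of `x`. Let N_k(A) count the (n+1)-subsets whose cone contains `x` and that have k
points of A below them. Double counting gives (k+1) N_{k+1}(A) = (n+1+k) N_k(A) - ∑_a (N_k(A) -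
N_k(A \ a)). Linear programming gives N_0(A) = 1 if some cone contains `x`, and 0 otherwise. So the
recursion determines every N_k from the cones alone: heights do not matter (`levelCount_congr`).
Raising `a` until it is below nothing then shows N_k(A \ a) ≤ N_k(A) (`levelCount_erase_le`), and
the recursion bounds N_k by binomial coefficients. Equality means that no deletion of at most k
points removes `x` from all cones, which for (1) is membership in the k-hull. -/

/-! ### Double counting and the recursion in k. -/

section Counting

variable {ι : Type*}

open Classical in
/-- The number of subsets `T` of `A` that satisfy `C` and have exactly `k` points of `A` below
them, where `b T p` says that `p` is below `T`. -/
noncomputable def levelCount (C : Finset ι → Prop) (b : Finset ι → ι → Prop) (A : Finset ι)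
    (k : ℕ) : ℕ :=
  {T ∈ A.powerset | C T ∧ (A.filter (b T)).card = k}.card

open Classical in
theorem levelCount_le_levelCount {C : Finset ι → Prop} {b b' : Finset ι → ι → Prop}
    {A B : Finset ι} {k : ℕ}
    (h : ∀ T ⊆ A, C T → {p ∈ A | b T p} = {p ∈ B | b' T p} ∧ T ⊆ B) :
    levelCount C b A k ≤ levelCount C b' B k := by
  refine Finset.card_le_card fun T hT => ?_
  simp only [Finset.mem_filter, Finset.mem_powerset] at hT ⊢
  obtain ⟨h1, h2⟩ := h T hT.1 hT.2.1
  exact ⟨h2, hT.2.1, h1 ▸ hT.2.2⟩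

/-- Every subset of `A` that contains a set satisfying `C` contains exactly one such set that has
no point of the subset below it. -/
def HasUniqueBottom (C : Finset ι → Prop) (b : Finset ι → ι → Prop) (A : Finset ι) : Prop :=
  ∀ R ⊆ A, (∃ T ⊆ R, C T) → ∃! T, T ⊆ R ∧ C T ∧ ∀ p ∈ R, ¬ b T p

theorem HasUniqueBottom.mono {C : Finset ι → Prop} {b : Finset ι → ι → Prop} {A B : Finset ι}
    (h : HasUniqueBottom C b A) (hBA : B ⊆ A) : HasUniqueBottom C b B :=
  fun R hR => h R (hR.trans hBA)

open Classical in
theorem levelCount_zero {C : Finset ι → Prop} {b : Finset ι → ι → Prop} {A : Finset ι}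
    (h : HasUniqueBottom C b A) :
    levelCount C b A 0 = if ∃ T ⊆ A, C T then 1 else 0 := by
  unfold levelCount
  split_ifs with hT
  · obtain ⟨T, ⟨h1, h2, h3⟩, hu⟩ := h A subset_rfl hT
    rw [Finset.card_eq_one]
    refine ⟨T, ?_⟩
    ext S
    simp only [Finset.mem_filter, Finset.mem_powerset, Finset.card_eq_zero,
      Finset.filter_eq_empty_iff, Finset.mem_singleton]
    constructor
    · rintro ⟨hS, hC, hb⟩
      exact hu S ⟨hS, hC, fun p hp => hb hp⟩
    · rintro rfl
      exact ⟨h1, h2, fun p hp => h3 p hp⟩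
  · rw [Finset.card_eq_zero, Finset.filter_eq_empty_iff]
    intro T hTA hC
    exact hT ⟨T, Finset.mem_powerset.1 hTA, hC.1⟩

open Classical in
/-- Double counting of pairs `(T, a)` with `a ∉ T`. -/
theorem sum_levelCount_erase {C : Finset ι → Prop} {b : Finset ι → ι → Prop} {m : ℕ}
    (hC : ∀ T, C T → T.card = m) (hb : ∀ T, C T → ∀ p ∈ T, ¬ b T p) (A : Finset ι) (k : ℕ) :
    ∑ a ∈ A, levelCount C b (A.erase a) k + (m + k) * levelCount C b A k =
      A.card * levelCount C b A k + (k + 1) * levelCount C b A (k + 1) := by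
  -- A set with k points below keeps that number when one of the `A.card - (m + k)` points neither
  -- in it nor below it is removed. A set with k + 1 points below drops to k when one of these is
  -- removed. No other set contributes.
  have key : ∀ T ∈ A.powerset.filter C,
      {a ∈ A | a ∉ T ∧ ((A.erase a).filter (b T)).card = k}.card +
        (if (A.filter (b T)).card = k then m + k else 0) =
        (if (A.filter (b T)).card = k then A.card else 0) +
        (if (A.filter (b T)).card = k + 1 then k + 1 else 0) := by
    intro T hT
    rw [Finset.mem_filter, Finset.mem_powerset] at hT
    obtain ⟨hTA, hCT⟩ := hT
    set B := A.filter (b T) with hB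
    have hdis : Disjoint T B := by
      rw [Finset.disjoint_left]
      intro p hp hpB
      exact hb T hCT p hp (Finset.mem_filter.1 hpB).2
    have hBA : B ⊆ A := Finset.filter_subset _ _
    have herase : ∀ a, (A.erase a).filter (b T) = B.erase a := fun a => by
      rw [hB, Finset.filter_erase]
    simp only [herase]
    by_cases h1 : B.card = k
    · have : {a ∈ A | a ∉ T ∧ (B.erase a).card = k} = A \ (T ∪ B) := by
        ext a
        simp only [Finset.mem_filter, Finset.mem_sdiff, Finset.mem_union, not_or]
        refine and_congr_right fun _ => and_congr_right fun _ => ?_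
        constructor
        · intro h ha
          have := Finset.card_erase_lt_of_mem ha
          omega
        · intro ha
          rw [Finset.erase_eq_of_notMem ha, h1]
      rw [this, Finset.card_sdiff_of_subset (Finset.union_subset hTA hBA)]
      have h2 := Finset.card_le_card (Finset.union_subset hTA hBA)
      rw [Finset.card_union_of_disjoint hdis, hC T hCT] at *
      simp [h1] at *
      omega
    · by_cases h2 : B.card = k + 1
      · have : {a ∈ A | a ∉ T ∧ (B.erase a).card = k} = B := by
          ext a
          simp only [Finset.mem_filter]
          constructor
          · rintro ⟨_, _, h⟩
            by_contra ha
            rw [Finset.erase_eq_of_notMem ha] at h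
            exact h1 h
          · intro ha
            refine ⟨hBA ha, fun h => Finset.disjoint_left.1 hdis h ha, ?_⟩
            rw [Finset.card_erase_of_mem ha, h2]; rfl
        rw [this]
        simp [h2]
      · have : {a ∈ A | a ∉ T ∧ (B.erase a).card = k} = ∅ := by
          rw [Finset.filter_eq_empty_iff]
          rintro a _ ⟨_, h⟩
          have := Finset.pred_card_le_card_erase (s := B) (a := a)
          have := Finset.card_erase_le (s := B) (a := a)
          omega
        rw [this]
        simp [h1, h2]
  have hN : ∀ j c : ℕ, ∑ T ∈ A.powerset.filter C,
      (if (A.filter (b T)).card = j then c else 0) = c * levelCount C b A j := by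
    intro j c
    rw [← Finset.sum_filter, Finset.sum_const, Finset.filter_filter, smul_eq_mul, mul_comm]
    rfl
  have hsum : ∑ a ∈ A, levelCount C b (A.erase a) k =
      ∑ T ∈ A.powerset.filter C,
        {a ∈ A | a ∉ T ∧ ((A.erase a).filter (b T)).card = k}.card := by
    have h1 : ∀ a ∈ A, levelCount C b (A.erase a) k =
        {T ∈ A.powerset.filter C | a ∉ T ∧ ((A.erase a).filter (b T)).card = k}.card := by
      intro a _
      unfold levelCount
      congr 1
      ext T
      simp only [Finset.mem_filter, Finset.mem_powerset, Finset.subset_erase]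
      tauto
    rw [Finset.sum_congr rfl h1]
    exact Finset.sum_card_bipartiteAbove_eq_sum_card_bipartiteBelow
      (r := fun a T => a ∉ T ∧ ((A.erase a).filter (b T)).card = k)
  have := Finset.sum_congr rfl key
  rw [Finset.sum_add_distrib, Finset.sum_add_distrib, hN, hN, hN, ← hsum] at this
  exact this

/-- The level counts depend only on which sets satisfy `C`. -/
theorem levelCount_congr {C : Finset ι → Prop} {b b' : Finset ι → ι → Prop} {m : ℕ}
    (hC : ∀ T, C T → T.card = m) (hb : ∀ T, C T → ∀ p ∈ T, ¬ b T p)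
    (hb' : ∀ T, C T → ∀ p ∈ T, ¬ b' T p) (k : ℕ) : ∀ {A : Finset ι},
    HasUniqueBottom C b A → HasUniqueBottom C b' A →
    levelCount C b A k = levelCount C b' A k := by
  classical
  induction k with
  | zero =>
    intro A h h'
    rw [levelCount_zero h, levelCount_zero h']
  | succ k ih =>
    intro A h h'
    have e1 := sum_levelCount_erase hC hb A k
    have e2 := sum_levelCount_erase hC hb' A k
    -- Everything in the recursion except the count at level k + 1 is at level k, for `A` or for
    -- `A.erase a`, where `b` and `b'` already agree.
    rw [ih h h', Finset.sum_congr rfl fun a _ =>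
      ih (h.mono (Finset.erase_subset a A)) (h'.mono (Finset.erase_subset a A)), e2] at e1
    have := Nat.add_left_cancel e1
    exact (Nat.eq_of_mul_eq_mul_left (Nat.succ_pos k) this).symm

-- The double count, rearranged so that under monotonicity the loss against the binomial recursion
-- is a sum of natural numbers with exact subtraction.
open Classical in
theorem succ_mul_levelCount_succ_add_sum {C : Finset ι → Prop} {b : Finset ι → ι → Prop} {n : ℕ}
    (hC : ∀ T, C T → T.card = n + 1) (hb : ∀ T, C T → ∀ p ∈ T, ¬ b T p) {A : Finset ι} (k : ℕ)
    (hmono : ∀ a ∈ A, levelCount C b (A.erase a) k ≤ levelCount C b A k) :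
    (k + 1) * levelCount C b A (k + 1) +
      ∑ a ∈ A, (levelCount C b A k - levelCount C b (A.erase a) k) =
      (n + 1 + k) * levelCount C b A k := by
  have e := sum_levelCount_erase hC hb A k
  have e2 : ∑ a ∈ A, (levelCount C b A k - levelCount C b (A.erase a) k) +
      ∑ a ∈ A, levelCount C b (A.erase a) k = A.card * levelCount C b A k := by
    rw [← Finset.sum_add_distrib, Finset.sum_congr rfl fun a ha => Nat.sub_add_cancel (hmono a ha),
      Finset.sum_const, smul_eq_mul]
  omega

/-- The binomial coefficients solve the same recursion with zero loss. -/
theorem succ_mul_choose_add_succ (n k : ℕ) :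
    (k + 1) * (n + (k + 1)).choose n = (n + 1 + k) * (n + k).choose n := by
  have h := Nat.add_one_mul_choose_eq (n + k) k
  rw [show (n + (k + 1)).choose n = (n + k + 1).choose (k + 1) from by
    rw [← add_assoc]; exact Nat.choose_symm_of_eq_add (by omega),
    show (n + k).choose n = (n + k).choose k from Nat.choose_symm_add, mul_comm, ← h]
  ring

open Classical in
theorem levelCount_le_choose {C : Finset ι → Prop} {b : Finset ι → ι → Prop} {n : ℕ}
    (hC : ∀ T, C T → T.card = n + 1) (hb : ∀ T, C T → ∀ p ∈ T, ¬ b T p) {A : Finset ι}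
    (hU : HasUniqueBottom C b A)
    (hmono : ∀ B ⊆ A, ∀ a ∈ B, ∀ k, levelCount C b (B.erase a) k ≤ levelCount C b B k) (k : ℕ) :
    levelCount C b A k ≤ (n + k).choose n := by
  induction k with
  | zero =>
    rw [levelCount_zero hU]
    split_ifs <;> simp
  | succ k ih =>
    have e := succ_mul_levelCount_succ_add_sum hC hb k fun a ha => hmono A subset_rfl a ha k
    have h2 := Nat.mul_le_mul_left (n + 1 + k) ih
    rw [← succ_mul_choose_add_succ] at h2
    have h3 : (k + 1) * levelCount C b A (k + 1) ≤ (k + 1) * (n + (k + 1)).choose n := by omega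
    exact Nat.le_of_mul_le_mul_left h3 (Nat.succ_pos k)

-- Equality at level k + 1 forces equality at level k and zero loss, that is, equality for every
-- `A.erase a` too. Deleting at most k + 1 points is deleting one and then at most k more.
open Classical in
theorem levelCount_eq_choose_iff {C : Finset ι → Prop} {b : Finset ι → ι → Prop} {n : ℕ}
    (hC : ∀ T, C T → T.card = n + 1) (hb : ∀ T, C T → ∀ p ∈ T, ¬ b T p) (k : ℕ) :
    ∀ {A : Finset ι}, HasUniqueBottom C b A →
    (∀ B ⊆ A, ∀ a ∈ B, ∀ k, levelCount C b (B.erase a) k ≤ levelCount C b B k) →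
    (levelCount C b A k = (n + k).choose n ↔
      ∀ F ⊆ A, F.card ≤ k → ∃ T ⊆ A \ F, C T) := by
  induction k with
  | zero =>
    intro A hU _
    rw [levelCount_zero hU]
    simp only [add_zero, Nat.choose_self, nonpos_iff_eq_zero, Finset.card_eq_zero]
    constructor
    · rintro h F - rfl
      by_contra hcon
      simp at hcon
      rw [if_neg (by push Not; exact hcon)] at h
      exact absurd h (by norm_num)
    · intro h
      have := h ∅ (Finset.empty_subset A) rfl
      rw [Finset.sdiff_empty] at this
      rw [if_pos this]
  | succ k ih =>
    intro A hU hmono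
    have e := succ_mul_levelCount_succ_add_sum hC hb k fun a ha => hmono A subset_rfl a ha k
    have hc := succ_mul_choose_add_succ n k
    have hle := levelCount_le_choose hC hb hU hmono k
    have ih' : ∀ a ∈ A, _ := fun a _ => ih (hU.mono (Finset.erase_subset a A))
      fun B hB => hmono B (hB.trans (Finset.erase_subset a A))
    have h1 : levelCount C b A (k + 1) = (n + (k + 1)).choose n ↔
        levelCount C b A k = (n + k).choose n ∧
          ∀ a ∈ A, levelCount C b (A.erase a) k = (n + k).choose n := by
      constructor
      · intro h
        rw [h, hc] at e
        have h2 : levelCount C b A k = (n + k).choose n := by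
          refine le_antisymm hle ?_
          have h5 : (n + 1 + k) * (n + k).choose n ≤ (n + 1 + k) * levelCount C b A k := by omega
          exact Nat.le_of_mul_le_mul_left h5 (by omega)
        refine ⟨h2, fun a ha => ?_⟩
        rw [h2] at e
        have h0 := Nat.add_eq_left.1 e
        rw [Finset.sum_eq_zero_iff] at h0
        have h3 := hmono A subset_rfl a ha k
        have h4 := h0 a ha
        omega
      · rintro ⟨h2, h3⟩
        rw [Finset.sum_eq_zero fun a ha => by rw [h2, h3 a ha, Nat.sub_self], h2, ← hc] at e
        exact Nat.eq_of_mul_eq_mul_left (Nat.succ_pos k) e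
    rw [h1, ih hU hmono]
    constructor
    · rintro ⟨h2, h3⟩ F hF hk
      rcases F.eq_empty_or_nonempty with rfl | ⟨a, ha⟩
      · exact h2 ∅ (Finset.empty_subset _) (by simp)
      · obtain ⟨T, hT, hCT⟩ := ((ih' a (hF ha)).1 (h3 a (hF ha))) (F.erase a)
          (Finset.erase_subset_erase a hF) (by rw [Finset.card_erase_of_mem ha]; omega)
        refine ⟨T, fun p hp => ?_, hCT⟩
        have := hT hp
        simp only [Finset.mem_sdiff, Finset.mem_erase, not_and] at this ⊢
        exact ⟨this.1.2, this.2 this.1.1⟩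
    · intro h
      refine ⟨fun F hF hk => h F hF (by omega), fun a ha => (ih' a ha).2 fun F hF hk => ?_⟩
      obtain ⟨T, hT, hCT⟩ := h (insert a F)
        (Finset.insert_subset ha (hF.trans (Finset.erase_subset a A)))
        ((Finset.card_insert_le a F).trans (by omega))
      refine ⟨T, fun p hp => ?_, hCT⟩
      have := hT hp
      simp only [Finset.mem_sdiff, Finset.mem_erase, Finset.mem_insert, not_or] at this ⊢
      exact ⟨⟨this.2.1, this.1⟩, this.2.2⟩

end Counting

/-! ### Cones, interpolating linear forms and the simplex method. -/

section Cones

variable {ι E : Type*} [AddCommGroup E] [Module ℝ E]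

/-- `x` lies in the convex cone generated by the vectors `v p`, `p ∈ T`. -/
def InCone (v : ι → E) (x : E) (T : Finset ι) : Prop :=
  ∃ μ : ι → ℝ, (∀ p ∈ T, 0 ≤ μ p) ∧ ∑ p ∈ T, μ p • v p = x

/-- A linear form that takes the value `w q` at `v q` for all `q ∈ T` is larger than `w p` at
`v p`. -/
def IsBelow (v : ι → E) (w : ι → ℝ) (T : Finset ι) (p : ι) : Prop :=
  ∃ g : E →ₗ[ℝ] ℝ, (∀ q ∈ T, g (v q) = w q) ∧ w p < g (v p)

theorem InCone.mono {v : ι → E} {x : E} {S T : Finset ι} (h : InCone v x T) (hTS : T ⊆ S) :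
    InCone v x S := by
  classical
  obtain ⟨μ, hμ, hsum⟩ := h
  refine ⟨fun p => if p ∈ T then μ p else 0, fun p _ => ?_, ?_⟩
  · by_cases h : p ∈ T
    · simpa [h] using hμ p h
    · simp [h]
  · rw [← hsum, ← Finset.sum_subset hTS fun p _ hp => by simp [hp]]
    exact Finset.sum_congr rfl fun p hp => by simp [hp]

theorem not_isBelow_of_mem {v : ι → E} {w : ι → ℝ} {T : Finset ι} {p : ι} (hp : p ∈ T) :
    ¬ IsBelow v w T p := by
  rintro ⟨g, hg, h⟩
  exact h.ne (hg p hp).symm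

/-- The vectors `v p`, `p ∈ A`, and `x` are in linearly general position, where the space has
dimension `n + 1`. -/
structure IsGeneralPosition (n : ℕ) (v : ι → E) (x : E) (A : Finset ι) : Prop where
  linearIndependent : ∀ T ⊆ A, T.card = n + 1 → LinearIndependent ℝ fun p : T => v p
  not_inCone : ∀ T ⊆ A, T.card < n + 1 → ¬ InCone v x T

/-- The heights `w p`, `p ∈ A`, are positive and no linear form interpolates more than `n + 1` of
them. -/
structure IsGenericHeight (n : ℕ) (v : ι → E) (w : ι → ℝ) (A : Finset ι) : Prop where
  pos : ∀ p ∈ A, 0 < w p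
  ne : ∀ T ⊆ A, T.card = n + 1 → ∀ p ∈ A, p ∉ T → ∀ g : E →ₗ[ℝ] ℝ,
    (∀ q ∈ T, g (v q) = w q) → g (v p) ≠ w p

theorem IsGeneralPosition.mono {n : ℕ} {v : ι → E} {x : E} {A B : Finset ι}
    (h : IsGeneralPosition n v x A) (hBA : B ⊆ A) : IsGeneralPosition n v x B :=
  ⟨fun T hT => h.1 T (hT.trans hBA), fun T hT => h.2 T (hT.trans hBA)⟩

theorem IsGenericHeight.mono {n : ℕ} {v : ι → E} {w : ι → ℝ} {A B : Finset ι}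
    (h : IsGenericHeight n v w A) (hBA : B ⊆ A) : IsGenericHeight n v w B :=
  ⟨fun p hp => h.1 p (hBA hp), fun T hT hc p hp => h.2 T (hT.trans hBA) hc p (hBA hp)⟩

variable {n : ℕ} {v : ι → E} {x : E} {w : ι → ℝ} {A : Finset ι}

theorem span_eq_top_of_card (hE : Module.finrank ℝ E = n + 1) {T : Finset ι}
    (hT : T.card = n + 1) (hli : LinearIndependent ℝ fun p : T => v p) :
    Submodule.span ℝ (Set.range fun p : T => v p) = ⊤ :=
  have := Module.finite_of_finrank_eq_succ hE
  hli.span_eq_top_of_card_eq_finrank' (by simp [hT, hE])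

theorem exists_linearForm (hE : Module.finrank ℝ E = n + 1) {T : Finset ι}
    (hT : T.card = n + 1) (hli : LinearIndependent ℝ fun p : T => v p) (w : ι → ℝ) :
    ∃ g : E →ₗ[ℝ] ℝ, ∀ q ∈ T, g (v q) = w q := by
  let B := Module.Basis.mk hli (span_eq_top_of_card hE hT hli).ge
  refine ⟨B.constr ℝ fun p : T => w p, fun q hq => ?_⟩
  have := B.constr_basis ℝ (fun p : T => w p) ⟨q, hq⟩
  simpa [B] using this

theorem linearForm_unique (hE : Module.finrank ℝ E = n + 1) {T : Finset ι}
    (hT : T.card = n + 1) (hli : LinearIndependent ℝ fun p : T => v p) {g g' : E →ₗ[ℝ] ℝ}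
    (h : ∀ q ∈ T, g (v q) = g' (v q)) : g = g' :=
  LinearMap.ext_on_range (span_eq_top_of_card hE hT hli) fun q => h q q.2

theorem exists_coeff (hE : Module.finrank ℝ E = n + 1) {T : Finset ι}
    (hT : T.card = n + 1) (hli : LinearIndependent ℝ fun p : T => v p) (y : E) :
    ∃ c : ι → ℝ, ∑ p ∈ T, c p • v p = y := by
  classical
  have hy : y ∈ Submodule.span ℝ (Set.range fun p : T => v p) := by
    rw [span_eq_top_of_card hE hT hli]; trivial
  obtain ⟨c, hc⟩ := (Submodule.mem_span_range_iff_exists_fun ℝ).1 hy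
  refine ⟨fun p => if h : p ∈ T then c ⟨p, h⟩ else 0, ?_⟩
  rw [← hc, ← Finset.sum_coe_sort T]
  exact Finset.sum_congr rfl fun p _ => by simp

theorem IsGeneralPosition.coeff_pos (hG : IsGeneralPosition n v x A) {T : Finset ι} (hTA : T ⊆ A)
    (hT : T.card = n + 1) {μ : ι → ℝ} (hμ : ∀ p ∈ T, 0 ≤ μ p) (hx : ∑ p ∈ T, μ p • v p = x) :
    ∀ p ∈ T, 0 < μ p := by
  classical
  intro p hp
  refine (hμ p hp).lt_of_ne fun h0 => ?_
  refine hG.not_inCone (T.erase p) ((Finset.erase_subset p T).trans hTA)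
    (by rw [Finset.card_erase_of_mem hp]; omega)
    ⟨μ, fun q hq => hμ q (Finset.mem_of_mem_erase hq), ?_⟩
  rw [← hx, ← Finset.add_sum_erase T _ hp, ← h0, zero_smul, zero_add]

/-- A pivot step: if `p` is below `T`, then `p` can be exchanged with an element of `T` so that the
interpolating linear form gets smaller at `x`. -/
theorem exists_pivot [DecidableEq ι] (hE : Module.finrank ℝ E = n + 1)
    (hG : IsGeneralPosition n v x A) (hw : ∀ p ∈ A, 0 < w p)
    {T : Finset ι} (hTA : T ⊆ A) (hT : T.card = n + 1) (hcone : InCone v x T) {p : ι} (hpA : p ∈ A)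
    {g : E →ₗ[ℝ] ℝ} (hg : ∀ q ∈ T, g (v q) = w q) (hp : w p < g (v p)) :
    ∃ q ∈ T, p ∉ T ∧ InCone v x (insert p (T.erase q)) ∧
      ∀ g' : E →ₗ[ℝ] ℝ, (∀ r ∈ insert p (T.erase q), g' (v r) = w r) → g' x < g x := by
  have hpT : p ∉ T := fun h => hp.ne (hg p h).symm
  obtain ⟨μ, hμ, hx⟩ := hcone
  have hμpos := hG.coeff_pos hTA hT hμ hx
  obtain ⟨c, hc⟩ := exists_coeff hE hT (hG.linearIndependent T hTA hT) (v p)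
  have hgp : g (v p) = ∑ q ∈ T, c q * w q := by
    rw [← hc, map_sum]
    exact Finset.sum_congr rfl fun q hq => by rw [map_smul, hg q hq, smul_eq_mul]
  -- Positive heights exclude an unbounded pivot: with all `c q ≤ 0` the value `g (v p)` would be
  -- nonpositive, yet it exceeds `w p > 0`.
  have hne : (T.filter fun q => 0 < c q).Nonempty := by
    by_contra hcon
    rw [Finset.not_nonempty_iff_eq_empty, Finset.filter_eq_empty_iff] at hcon
    have : ∑ q ∈ T, c q * w q ≤ 0 := Finset.sum_nonpos fun q hq =>
      mul_nonpos_of_nonpos_of_nonneg (not_lt.1 (hcon hq)) (hw q (hTA hq)).le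
    have := hw p hpA
    linarith
  -- The ratio test: `τ` is the largest multiple of `v p` that can enter while all coefficients stay
  -- nonnegative, and `q` leaves.
  obtain ⟨q, hq, hmin⟩ := Finset.exists_min_image _ (fun q => μ q / c q) hne
  rw [Finset.mem_filter] at hq
  obtain ⟨hqT, hcq⟩ := hq
  set τ := μ q / c q with hτ
  have hτpos : 0 < τ := div_pos (hμpos q hqT) hcq
  let ν : ι → ℝ := fun r => if r = p then τ else μ r - τ * c r
  have hνq : μ q - τ * c q = 0 := by rw [hτ]; field_simp; ring
  have hpe : p ∉ T.erase q := fun h => hpT (Finset.mem_of_mem_erase h)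
  have hνp : ν p = τ := if_pos rfl
  have hνr : ∀ r ∈ T.erase q, ν r = μ r - τ * c r := fun r hr => by
    refine if_neg ?_
    rintro rfl
    exact hpe hr
  have hsum : ∑ r ∈ insert p (T.erase q), ν r • v r = x := by
    rw [Finset.sum_insert hpe, hνp,
      Finset.sum_congr rfl fun r hr => by rw [hνr r hr],
      ← hx, ← eq_sub_iff_add_eq', ← hc, Finset.smul_sum, ← Finset.sum_sub_distrib,
      ← Finset.add_sum_erase T (fun r => μ r • v r - τ • c r • v r) hqT, smul_smul, ← sub_smul,
      hνq, zero_smul, zero_add]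
    exact Finset.sum_congr rfl fun r _ => by rw [sub_smul, smul_smul]
  refine ⟨q, hqT, hpT, ⟨ν, ?_, hsum⟩, fun g' hg' => ?_⟩
  · intro r hr
    rw [Finset.mem_insert] at hr
    rcases hr with rfl | hr
    · rw [hνp]; exact hτpos.le
    · rw [hνr r hr]
      have hrT := Finset.mem_of_mem_erase hr
      rcases lt_or_ge 0 (c r) with h | h
      · have := hmin r (Finset.mem_filter.2 ⟨hrT, h⟩)
        rw [le_div_iff₀ h] at this
        linarith
      · have := mul_nonpos_of_nonneg_of_nonpos hτpos.le h
        linarith [hμ r hrT]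
  · have e1 : g' x = g x + τ * (w p - g (v p)) := by
      have e2 : g' x = ∑ r ∈ insert p (T.erase q), ν r * w r := by
        rw [← hsum, map_sum]
        exact Finset.sum_congr rfl fun r hr => by rw [map_smul, hg' r hr, smul_eq_mul]
      have e3 : g x = ∑ r ∈ insert p (T.erase q), ν r * g (v r) := by
        rw [← hsum, map_sum]
        exact Finset.sum_congr rfl fun r hr => by rw [map_smul, smul_eq_mul]
      rw [e2, e3, Finset.sum_insert hpe, Finset.sum_insert hpe, hνp,
        Finset.sum_congr rfl fun r hr => congrArg (ν r * ·) (hg r (Finset.mem_of_mem_erase hr))]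
      ring
    have := mul_pos hτpos (sub_pos.2 hp)
    linarith

/-- Linear programming: a set minimizing the interpolated height at `x` is a bottom, since a point
below it would allow an improving pivot. Uniqueness is weak duality together with generic heights.
-/
theorem hasUniqueBottom_isBelow (hE : Module.finrank ℝ E = n + 1)
    (hG : IsGeneralPosition n v x A) (hw : IsGenericHeight n v w A) :
    HasUniqueBottom (fun T => T.card = n + 1 ∧ InCone v x T) (IsBelow v w) A := by
  classical
  rintro R hRA ⟨T₀, hT₀R, hT₀, hT₀x⟩
  let F : Finset ι → E →ₗ[ℝ] ℝ := fun T =>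
    if h : ∃ g : E →ₗ[ℝ] ℝ, ∀ q ∈ T, g (v q) = w q then h.choose else 0
  have hF : ∀ T ⊆ A, T.card = n + 1 → ∀ q ∈ T, F T (v q) = w q := by
    intro T hTA hT
    have h := exists_linearForm hE hT (hG.linearIndependent T hTA hT) w
    simp only [F, dif_pos h]
    exact h.choose_spec
  obtain ⟨T, hT, hmin⟩ := Finset.exists_min_image
    {T ∈ R.powerset | T.card = n + 1 ∧ InCone v x T} (fun T => F T x)
    ⟨T₀, Finset.mem_filter.2 ⟨Finset.mem_powerset.2 hT₀R, hT₀, hT₀x⟩⟩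
  rw [Finset.mem_filter, Finset.mem_powerset] at hT
  obtain ⟨hTR, hTc, hTx⟩ := hT
  refine ⟨T, ⟨hTR, ⟨hTc, hTx⟩, ?_⟩, ?_⟩
  · rintro p hpR ⟨g, hg, hp⟩
    obtain ⟨q, hqT, hpT, hcone, hlt⟩ :=
      exists_pivot hE hG hw.pos (hTR.trans hRA) hTc hTx (hRA hpR) hg hp
    have hsub : insert p (T.erase q) ⊆ R :=
      Finset.insert_subset hpR ((Finset.erase_subset q T).trans hTR)
    have hcard : (insert p (T.erase q)).card = n + 1 := by
      rw [Finset.card_insert_of_notMem fun h => hpT (Finset.mem_of_mem_erase h),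
        Finset.card_erase_of_mem hqT, hTc]
      rfl
    have h1 := hmin _ (Finset.mem_filter.2 ⟨Finset.mem_powerset.2 hsub, hcard, hcone⟩)
    have h2 := hlt _ (hF _ (hsub.trans hRA) hcard)
    have h3 : F T = g := linearForm_unique hE hTc (hG.linearIndependent T (hTR.trans hRA) hTc)
      fun q hq => by rw [hF T (hTR.trans hRA) hTc q hq, hg q hq]
    rw [h3] at h1
    exact absurd h2 (not_lt.2 h1)
  · rintro S ⟨hSR, ⟨hSc, hSx⟩, hS⟩
    have hTA := hTR.trans hRA
    have hSA := hSR.trans hRA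
    have hle : ∀ U ⊆ R, U.card = n + 1 → (∀ p ∈ R, ¬ IsBelow v w U p) →
        ∀ p ∈ R, F U (v p) ≤ w p := by
      intro U hUR hUc hU p hp
      by_contra hcon
      exact hU p hp ⟨F U, hF U (hUR.trans hRA) hUc, not_le.1 hcon⟩
    have hxle : F T x ≤ F S x := hmin S
      (Finset.mem_filter.2 ⟨Finset.mem_powerset.2 hSR, hSc, hSx⟩)
    obtain ⟨μ, hμ, hx⟩ := hTx
    have hμpos := hG.coeff_pos hTA hTc hμ hx
    have hterm : ∀ p ∈ T, μ p * F S (v p) ≤ μ p * w p := fun p hp =>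
      mul_le_mul_of_nonneg_left (hle S hSR hSc hS p (hTR hp)) (hμ p hp)
    have e1 : F T x = ∑ p ∈ T, μ p * w p := by
      rw [← hx, map_sum]
      exact Finset.sum_congr rfl fun p hp => by
        rw [map_smul, hF T hTA hTc p hp, smul_eq_mul]
    have e2 : F S x = ∑ p ∈ T, μ p * F S (v p) := by
      rw [← hx, map_sum]
      exact Finset.sum_congr rfl fun p hp => by rw [map_smul, smul_eq_mul]
    -- Minimality of `T` makes weak duality tight, and the coefficients are positive, so the form of
    -- `S` attains the heights on all of `T`; genericity then gives `T ⊆ S`.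
    have heq := (Finset.sum_eq_sum_iff_of_le hterm).1
      (le_antisymm (Finset.sum_le_sum hterm) (by rw [← e1, ← e2]; exact hxle))
    have hTS : T ⊆ S := by
      intro p hp
      by_contra hpS
      exact hw.ne S hSA hSc p (hTA hp) hpS (F S) (hF S hSA hSc)
        (mul_left_cancel₀ (hμpos p hp).ne' (heq p hp))
    exact (Finset.eq_of_subset_of_card_le hTS (by rw [hSc, hTc])).symm

/-- The height of one point can be raised generically so that it is below no simplex. -/
theorem exists_update_isGenericHeight [DecidableEq ι] (hE : Module.finrank ℝ E = n + 1)
    (hG : IsGeneralPosition n v x A) (hw : IsGenericHeight n v w A) {a : ι} (ha : a ∈ A) :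
    ∃ W : ℝ, IsGenericHeight n v (Function.update w a W) A ∧
      ∀ T ⊆ A, T.card = n + 1 → a ∉ T → ¬ IsBelow v (Function.update w a W) T a := by
  have hup : ∀ {W : ℝ} {q : ι}, q ≠ a → Function.update w a W q = w q := fun h =>
    Function.update_of_ne h _ _
  let bad : Finset ι × ι → Set ℝ := fun Tp =>
    {W | ∃ g : E →ₗ[ℝ] ℝ, (∀ q ∈ Tp.1, g (v q) = Function.update w a W q) ∧
      g (v Tp.2) = Function.update w a W Tp.2}
  let I := {Tp ∈ A.powerset ×ˢ A | Tp.1.card = n + 1 ∧ Tp.2 ∉ Tp.1 ∧ a ∈ insert Tp.2 Tp.1}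
  -- The n + 1 points other than `a` determine the form, and its value at `v a` is the only bad
  -- height.
  have hbad : ∀ Tp ∈ I, (bad Tp).Subsingleton := by
    rintro ⟨T, p⟩ hTp W₁ ⟨g₁, hg₁, hp₁⟩ W₂ ⟨g₂, hg₂, hp₂⟩
    simp only [I, Finset.mem_filter, Finset.mem_product, Finset.mem_powerset] at hTp
    obtain ⟨⟨hTA, hpA⟩, hTc, hpT, haT⟩ := hTp
    have hins : ∀ q ∈ insert p T, q ≠ a → g₁ (v q) = g₂ (v q) := by
      intro q hq hqa
      rw [Finset.mem_insert] at hq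
      rcases hq with rfl | hq
      · simp only at hp₁ hp₂
        rw [hp₁, hp₂, hup hqa, hup hqa]
      · rw [hg₁ q hq, hg₂ q hq, hup hqa, hup hqa]
    have hc : ((insert p T).erase a).card = n + 1 := by
      rw [Finset.card_erase_of_mem haT, Finset.card_insert_of_notMem hpT, hTc]; rfl
    have h := linearForm_unique hE hc (hG.linearIndependent _
      ((Finset.erase_subset _ _).trans (Finset.insert_subset hpA hTA)) hc)
      (g := g₁) (g' := g₂) fun q hq =>
        hins q (Finset.mem_of_mem_erase hq) (Finset.ne_of_mem_erase hq)
    have ha1 : ∀ {W : ℝ} {g : E →ₗ[ℝ] ℝ}, (∀ q ∈ T, g (v q) = Function.update w a W q) →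
        g (v p) = Function.update w a W p → g (v a) = W := by
      intro W g hg hp
      rw [Finset.mem_insert] at haT
      rcases haT with h | h
      · subst h; simpa using hp
      · simpa using hg a h
    rw [← ha1 hg₁ hp₁, ← ha1 hg₂ hp₂, h]
  have hfin : (⋃ Tp ∈ I, bad Tp).Finite :=
    I.finite_toSet.biUnion fun Tp hTp => (hbad Tp hTp).finite
  have hF : ∀ T ∈ {T ∈ A.powerset | T.card = n + 1}, ∃ g : E →ₗ[ℝ] ℝ, ∀ q ∈ T, g (v q) = w q := by
    intro T hT
    rw [Finset.mem_filter, Finset.mem_powerset] at hT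
    exact exists_linearForm hE hT.2 (hG.linearIndependent T hT.1 hT.2) w
  choose! F hF using hF
  obtain ⟨M, hM⟩ := (Finset.image (fun T => F T (v a)) {T ∈ A.powerset | T.card = n + 1}).bddAbove
  obtain ⟨W, hWM, hW⟩ := (Set.Ioi_infinite (max M 0)).exists_notMem_finite hfin
  rw [Set.mem_Ioi, max_lt_iff] at hWM
  refine ⟨W, ⟨fun p hp => ?_, ?_⟩, ?_⟩
  · by_cases h : p = a
    · subst h; simpa using hWM.2
    · rw [hup h]; exact hw.pos p hp
  · intro T hTA hTc p hp hpT g hg hgp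
    by_cases haT : a ∈ insert p T
    · refine hW (Set.mem_biUnion (x := (T, p)) ?_ ⟨g, hg, hgp⟩)
      simp only [I, Finset.coe_filter, Finset.mem_product, Finset.mem_powerset, Set.mem_ofPred_eq]
      exact ⟨⟨hTA, hp⟩, hTc, hpT, haT⟩
    · rw [Finset.mem_insert, not_or] at haT
      rw [hup (Ne.symm haT.1)] at hgp
      refine hw.ne T hTA hTc p hp hpT g (fun q hq => ?_) hgp
      rw [hg q hq, hup]
      rintro rfl
      exact haT.2 hq
  · rintro T hTA hTc haT ⟨g, hg, hlt⟩
    have hTm : T ∈ {T ∈ A.powerset | T.card = n + 1} :=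
      Finset.mem_filter.2 ⟨Finset.mem_powerset.2 hTA, hTc⟩
    have hgF : g = F T := linearForm_unique hE hTc (hG.linearIndependent T hTA hTc) fun q hq => by
      rw [hg q hq, hF T hTm q hq, hup]
      rintro rfl
      exact haT hq
    rw [Function.update_self, hgF] at hlt
    have := hM (Finset.mem_coe.2 (Finset.mem_image_of_mem (fun T => F T (v a)) hTm))
    linarith [hWM.1]

-- Changing the height of `a` leaves the right-hand count unchanged by `levelCount_congr`. Once `a`
-- is below no set, each set counted on the left is also counted on the right.
open Classical in
theorem levelCount_erase_le (hE : Module.finrank ℝ E = n + 1)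
    (hG : IsGeneralPosition n v x A) (hw : IsGenericHeight n v w A) {a : ι} (ha : a ∈ A) (k : ℕ) :
    levelCount (fun T => T.card = n + 1 ∧ InCone v x T) (IsBelow v w) (A.erase a) k ≤
      levelCount (fun T => T.card = n + 1 ∧ InCone v x T) (IsBelow v w) A k := by
  obtain ⟨W, hW, hWa⟩ := exists_update_isGenericHeight hE hG hw ha
  rw [levelCount_congr (m := n + 1) (A := A) (fun T hT => hT.1)
    (fun T _ p hp => not_isBelow_of_mem hp)
    (fun T _ p hp => not_isBelow_of_mem (w := Function.update w a W) hp) k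
    (hasUniqueBottom_isBelow hE hG hw) (hasUniqueBottom_isBelow hE hG hW)]
  refine levelCount_le_levelCount fun T hT hC => ?_
  rw [Finset.subset_erase] at hT
  obtain ⟨hTA, haT⟩ := hT
  refine ⟨?_, hTA⟩
  ext p
  simp only [Finset.mem_filter, Finset.mem_erase]
  have hq : ∀ q, q ≠ a → Function.update w a W q = w q := fun q h => Function.update_of_ne h _ _
  have hqT : ∀ q ∈ T, Function.update w a W q = w q := fun q h => hq q (by
    rintro rfl; exact haT h)
  constructor
  · rintro ⟨⟨hpa, hp⟩, g, hg, hlt⟩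
    refine ⟨hp, g, fun q h => by rw [hg q h, hqT q h], ?_⟩
    rwa [hq p hpa]
  · rintro ⟨hp, hb⟩
    have hpa : p ≠ a := by
      rintro rfl
      exact hWa T hTA hC.1 haT hb
    obtain ⟨g, hg, hlt⟩ := hb
    rw [hq p hpa] at hlt
    exact ⟨⟨hpa, hp⟩, g, fun q h => by rw [hg q h, hqT q h], hlt⟩

theorem levelCount_isBelow_le_choose (hE : Module.finrank ℝ E = n + 1)
    (hG : IsGeneralPosition n v x A) (hw : IsGenericHeight n v w A) (k : ℕ) :
    levelCount (fun T => T.card = n + 1 ∧ InCone v x T) (IsBelow v w) A k ≤ (n + k).choose n :=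
  levelCount_le_choose (fun _ hT => hT.1) (fun _ _ _ hp => not_isBelow_of_mem hp)
    (hasUniqueBottom_isBelow hE hG hw)
    (fun _ hB _ ha k => by
      convert levelCount_erase_le hE (hG.mono hB) (hw.mono hB) ha k) k

open Classical in
theorem levelCount_isBelow_eq_choose_iff (hE : Module.finrank ℝ E = n + 1)
    (hG : IsGeneralPosition n v x A) (hw : IsGenericHeight n v w A) (k : ℕ) :
    levelCount (fun T => T.card = n + 1 ∧ InCone v x T) (IsBelow v w) A k = (n + k).choose n ↔
      ∀ F ⊆ A, F.card ≤ k → ∃ T ⊆ A \ F, T.card = n + 1 ∧ InCone v x T :=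
  levelCount_eq_choose_iff (fun _ hT => hT.1) (fun _ _ _ hp => not_isBelow_of_mem hp) k
    (hasUniqueBottom_isBelow hE hG hw)
    (fun _ hB _ ha k => levelCount_erase_le hE (hG.mono hB) (hw.mono hB) ha k)

end Cones

/-! ### Spheres as interpolating linear forms. -/

section Spheres

variable {d : ℕ}

local notation "𝔼" => EuclideanSpace ℝ (Fin d)

theorem exists_inner_eq (g : 𝔼 →ₗ[ℝ] ℝ) : ∃ u : 𝔼, ∀ y, g y = ⟪u, y⟫ := by
  refine ⟨(InnerProductSpace.toDual ℝ 𝔼).symm (LinearMap.toContinuousLinearMap g), fun y => ?_⟩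
  rw [InnerProductSpace.toDual_symm_apply]
  rfl

theorem exists_inner_add_mul_eq (g : 𝔼 × ℝ →ₗ[ℝ] ℝ) :
    ∃ (u : 𝔼) (e : ℝ), ∀ y s, g (y, s) = ⟪u, y⟫ + s * e := by
  obtain ⟨u, hu⟩ := exists_inner_eq (g ∘ₗ LinearMap.inl ℝ 𝔼 ℝ)
  refine ⟨u, g (0, 1), fun y s => ?_⟩
  rw [← hu, ← smul_eq_mul, ← map_smul, LinearMap.comp_apply, ← map_add]
  simp

theorem exists_pos_sq_eq {T : Finset 𝔼} (hT : 2 ≤ T.card) {c : 𝔼} {ρ : ℝ}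
    (h : ∀ p ∈ T, ‖p - c‖ ^ 2 = ρ) : ∃ r : ℝ, 0 < r ∧ ρ = r ^ 2 := by
  obtain ⟨p, hp, q, hq, hpq⟩ := Finset.one_lt_card.1 hT
  have : 0 < ρ := by
    rcases eq_or_ne p c with rfl | hpc
    · rw [← h q hq]
      exact pow_pos (norm_pos_iff.2 (sub_ne_zero.2 hpq.symm)) 2
    · rw [← h p hp]
      exact pow_pos (norm_pos_iff.2 (sub_ne_zero.2 hpc)) 2
  exact ⟨√ρ, Real.sqrt_pos.2 this, (Real.sq_sqrt this.le).symm⟩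

theorem mem_sphere_iff_norm_sq {c p : 𝔼} {r : ℝ} (hr : 0 < r) :
    p ∈ Metric.sphere c r ↔ ‖p - c‖ ^ 2 = r ^ 2 := by
  rw [mem_sphere_iff_norm, sq_eq_sq₀ (norm_nonneg _) hr.le]

theorem mem_ball_iff_norm_sq {c p : 𝔼} {r : ℝ} (hr : 0 < r) :
    p ∈ Metric.ball c r ↔ ‖p - c‖ ^ 2 < r ^ 2 := by
  rw [mem_ball_iff_norm, sq_lt_sq₀ (norm_nonneg _) hr.le]

theorem IsGeneric.norm_sq_ne {S : Set 𝔼} (hS : IsGeneric S) {T : Finset 𝔼} (hTS : (T : Set 𝔼) ⊆ S)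
    (hT : T.card = d + 2) (c : 𝔼) (ρ : ℝ) : ¬ ∀ p ∈ T, ‖p - c‖ ^ 2 = ρ := by
  intro h
  obtain ⟨r, hr, rfl⟩ := exists_pos_sq_eq (by omega) h
  exact hS.2 T hTS hT ⟨c, r, hr, fun p hp => (mem_sphere_iff_norm_sq hr).2 (h p hp)⟩

open Classical in
/-- For a fixed lifting, the circumscribed sphere of `T` is given by the linear form that
interpolates the heights on `T`. -/
theorem exists_sphere_iff_card_isBelow {E : Type*} [AddCommGroup E] [Module ℝ E] {n : ℕ}
    (hE : Module.finrank ℝ E = n + 1) {v : 𝔼 → E} {w : 𝔼 → ℝ} {T U : Finset 𝔼}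
    (hT : T.card = n + 1) (hU : 2 ≤ U.card) (hli : LinearIndependent ℝ fun p : T => v p)
    (toSphere : ∀ g : E →ₗ[ℝ] ℝ, (∀ p ∈ T, g (v p) = w p) →
      ∃ (c : 𝔼) (ρ : ℝ), (∀ p, w p - g (v p) = ‖p - c‖ ^ 2 - ρ) ∧ ∀ p ∈ U, ‖p - c‖ ^ 2 = ρ)
    (ofSphere : ∀ (c : 𝔼) (ρ : ℝ), (∀ p ∈ U, ‖p - c‖ ^ 2 = ρ) →
      ∃ g : E →ₗ[ℝ] ℝ, (∀ p, w p - g (v p) = ‖p - c‖ ^ 2 - ρ) ∧ ∀ p ∈ T, g (v p) = w p)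
    (A : Finset 𝔼) (k : ℕ) :
    (∃ (c : 𝔼) (r : ℝ), 0 < r ∧ (∀ p ∈ U, p ∈ Metric.sphere c r) ∧
      (A.filter fun p => p ∈ Metric.ball c r).card = k) ↔
      (A.filter (IsBelow v w T)).card = k := by
  -- `w p - g (v p)` is the power of `p` with respect to the sphere, negative exactly inside.
  have key : ∀ (g : E →ₗ[ℝ] ℝ) (c : 𝔼) (r : ℝ), 0 < r → (∀ p ∈ T, g (v p) = w p) →
      (∀ p, w p - g (v p) = ‖p - c‖ ^ 2 - r ^ 2) →
      (A.filter fun p => p ∈ Metric.ball c r) = A.filter (IsBelow v w T) := by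
    intro g c r hr hg h
    refine Finset.filter_congr fun p _ => ?_
    rw [mem_ball_iff_norm_sq hr, ← sub_neg, ← h p, sub_neg]
    constructor
    · exact fun hlt => ⟨g, hg, hlt⟩
    · rintro ⟨g', hg', hlt⟩
      have : g = g' := linearForm_unique hE hT hli fun q hq => by rw [hg q hq, hg' q hq]
      rwa [this]
  constructor
  · rintro ⟨c, r, hr, hs, hk⟩
    obtain ⟨g, h, hg⟩ := ofSphere c (r ^ 2) fun p hp => (mem_sphere_iff_norm_sq hr).1 (hs p hp)
    rw [← key g c r hr hg h, hk]
  · intro hk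
    obtain ⟨g, hg⟩ := exists_linearForm hE hT hli w
    obtain ⟨c, ρ, h, hU'⟩ := toSphere g hg
    obtain ⟨r, hr, rfl⟩ := exists_pos_sq_eq hU hU'
    exact ⟨c, r, hr, fun p hp => (mem_sphere_iff_norm_sq hr).2 (hU' p hp),
      by rw [key g c r hr hg h, hk]⟩

end Spheres

/-! ### Part (1): the paraboloid lift and the k-hull. -/

section Affine

variable {d : ℕ}

local notation "𝔼" => EuclideanSpace ℝ (Fin d)

theorem finrank_euclidean_prod : Module.finrank ℝ (𝔼 × ℝ) = d + 1 := by
  simp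

theorem mem_convexHull_iff_inCone {T : Finset 𝔼} {x : 𝔼} :
    x ∈ convexHull ℝ (T : Set 𝔼) ↔ InCone (fun p : 𝔼 => (p, (1 : ℝ))) (x, 1) T := by
  rw [Finset.mem_convexHull', InCone]
  refine exists_congr fun μ => and_congr_right fun _ => ?_
  rw [Prod.ext_iff, Prod.fst_sum, Prod.snd_sum, and_comm]
  simp

theorem exists_hyperplane_of_span_ne_top {T : Finset 𝔼} (hT : T.Nonempty)
    (h : Submodule.span ℝ (Set.range fun p : T => ((p : 𝔼), (1 : ℝ))) ≠ ⊤) :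
    ∃ (u : 𝔼) (t : ℝ), u ≠ 0 ∧ (∀ p ∈ T, ⟪u, p⟫ = t) ∧
      ∀ x : 𝔼, InCone (fun p : 𝔼 => (p, (1 : ℝ))) (x, 1) T → ⟪u, x⟫ = t := by
  obtain ⟨f, hf, hle⟩ := Submodule.exists_le_ker_of_lt_top _ h.lt_top
  obtain ⟨u, e, hue⟩ := exists_inner_add_mul_eq f
  have hfT : ∀ p ∈ T, f (p, 1) = 0 := fun p hp =>
    LinearMap.mem_ker.1 (hle (Submodule.subset_span ⟨⟨p, hp⟩, rfl⟩))
  refine ⟨u, -e, ?_, fun p hp => ?_, ?_⟩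
  · rintro rfl
    obtain ⟨p, hp⟩ := hT
    have he := hfT p hp
    rw [hue, inner_zero_left, one_mul, zero_add] at he
    apply hf
    ext y <;> simp [hue, he]
  · have := hfT p hp
    rw [hue] at this
    linarith
  · rintro x ⟨μ, -, hx⟩
    have : f (x, 1) = 0 := by
      rw [← hx, map_sum]
      exact Finset.sum_eq_zero fun p hp => by rw [map_smul, hfT p hp, smul_zero]
    rw [hue] at this
    linarith

/-- Genericity speaks only of exactly `d + 1` points, so a small set whose cone contains `x` is
first padded to `d` points of `A`; with `x` these would lie on a hyperplane. Hence the need for `d ≤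
A.card`. -/
theorem IsGenericWrt.isGeneralPosition (hd : 1 ≤ d) {A : Finset 𝔼} (hcard : d ≤ A.card)
    (hA : IsGeneric (A : Set 𝔼)) {x : 𝔼} (hx : IsGenericWrt (A : Set 𝔼) x) :
    IsGeneralPosition d (fun p : 𝔼 => (p, (1 : ℝ))) (x, 1) A := by
  classical
  refine ⟨fun T hTA hT => ?_, fun T hTA hT hcone => ?_⟩
  · refine linearIndependent_of_top_le_span_of_card_eq_finrank ?_ (by simp [hT])
    by_contra h
    obtain ⟨u, t, hu, hT', -⟩ := exists_hyperplane_of_span_ne_top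
      (Finset.card_pos.1 (by omega)) fun h' => h h'.ge
    exact hA.1 T (by exact_mod_cast hTA) hT ⟨u, t, hu, hT'⟩
  · obtain ⟨S, hTS, hSA, hS⟩ := Finset.exists_subsuperset_card_eq hTA (Nat.lt_succ_iff.1 hT) hcard
    have hspan : Submodule.span ℝ (Set.range fun p : S => ((p : 𝔼), (1 : ℝ))) ≠ ⊤ := by
      intro h
      have := finrank_range_le_card (R := ℝ) fun p : S => ((p : 𝔼), (1 : ℝ))
      rw [Set.finrank, h, finrank_top, finrank_euclidean_prod, Fintype.card_coe] at this
      omega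
    obtain ⟨u, t, hu, hSt, hxt⟩ := exists_hyperplane_of_span_ne_top
      (Finset.card_pos.1 (by omega)) hspan
    have hxS : x ∉ S := fun h => hx.1 (hSA h)
    refine hx.2.1 (insert x S) ?_ (by rw [Finset.card_insert_of_notMem hxS, hS])
      ⟨u, t, hu, fun p hp => ?_⟩
    · rw [Finset.coe_insert, Set.insert_eq, Set.union_comm]
      exact Set.union_subset_union_left _ (by exact_mod_cast hSA)
    · rcases Finset.mem_insert.1 hp with rfl | hp
      · exact hxt _ (hcone.mono hTS)
      · exact hSt p hp

/-- Complete the square. The extra 1 keeps the height positive even at the origin. -/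
theorem exists_center_of_linearForm (g : 𝔼 × ℝ →ₗ[ℝ] ℝ) :
    ∃ (c : 𝔼) (ρ : ℝ), ∀ p : 𝔼, ‖p‖ ^ 2 + 1 - g (p, 1) = ‖p - c‖ ^ 2 - ρ := by
  obtain ⟨u, e, hue⟩ := exists_inner_add_mul_eq g
  refine ⟨(1 / 2 : ℝ) • u, e - 1 + ‖(1 / 2 : ℝ) • u‖ ^ 2, fun p => ?_⟩
  rw [hue, norm_sub_sq_real, real_inner_smul_right, real_inner_comm]
  ring

theorem exists_linearForm_of_center (c : 𝔼) (ρ : ℝ) :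
    ∃ g : 𝔼 × ℝ →ₗ[ℝ] ℝ, ∀ p : 𝔼, ‖p‖ ^ 2 + 1 - g (p, 1) = ‖p - c‖ ^ 2 - ρ := by
  refine ⟨(innerₗ 𝔼 ((2 : ℝ) • c)).coprod ((ρ - ‖c‖ ^ 2 + 1) • LinearMap.id), fun p => ?_⟩
  rw [norm_sub_sq_real, LinearMap.coprod_apply, innerₗ_apply_apply, real_inner_smul_left,
    real_inner_comm]
  simp
  ring

theorem IsGeneric.isGenericHeight {A : Finset 𝔼} (hA : IsGeneric (A : Set 𝔼)) :
    IsGenericHeight d (fun p : 𝔼 => (p, (1 : ℝ))) (fun p => ‖p‖ ^ 2 + 1) A := by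
  classical
  refine ⟨fun p _ => by positivity, fun T hTA hT p hp hpT g hg hgp => ?_⟩
  obtain ⟨c, ρ, h⟩ := exists_center_of_linearForm g
  refine hA.norm_sq_ne (T := insert p T)
    (by exact_mod_cast Finset.insert_subset hp hTA)
    (by rw [Finset.card_insert_of_notMem hpT, hT]) c ρ fun q hq => ?_
  have := h q
  rcases Finset.mem_insert.1 hq with rfl | hq
  · rw [hgp] at this; linarith
  · rw [hg q hq] at this; linarith

open Classical in
/-- The coercion of a finset of finsets to a finset of sets does not change cardinalities. -/
theorem card_filter_bind_coe {α : Type*} (s : Finset (Finset α)) (P : Set α → Prop)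
    [DecidablePred P] [DecidablePred fun T : Finset α => P (T : Set α)] :
    {S ∈ (s >>= fun T => pure (T : Set α) : Finset (Set α)) | P S}.card =
      (s.filter fun T : Finset α => P (T : Set α)).card := by
  rw [← Finset.card_image_of_injective (s.filter fun T : Finset α => P (T : Set α))
    (Finset.coe_injective (α := α))]
  refine congrArg Finset.card (Finset.ext fun S => ?_)
  simp only [Finset.mem_filter, Finset.bind_def, Finset.mem_sup, Finset.pure_def,
    Finset.mem_singleton, Finset.mem_image]
  constructor
  · rintro ⟨⟨T, hT, rfl⟩, hP⟩
    exact ⟨T, ⟨hT, hP⟩, rfl⟩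
  · rintro ⟨T, ⟨hT, hP⟩, rfl⟩
    exact ⟨⟨T, hT, rfl⟩, hP⟩

-- The filter in `coverNumber` runs over a finset of sets, through a coercion; this returns to
-- finsets of vertices.
open Classical in
theorem coverNumber_eq_card (A : Finset 𝔼) (k : ℕ) (x : 𝔼) :
    coverNumber A k x =
      ((heftySimplices A k).filter fun T : Finset 𝔼 => x ∈ convexHull ℝ (T : Set 𝔼)).card :=
  card_filter_bind_coe _ fun S => x ∈ convexHull ℝ S

open Classical in
theorem incidentCoverNumber_eq_card (A : Finset 𝔼) (k : ℕ) (a x : 𝔼) :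
    incidentCoverNumber A k a x =
      ((heftySimplices A k).filter fun T : Finset 𝔼 =>
        a ∈ (T : Set 𝔼) ∧ x ∈ convexHull ℝ (T : Set 𝔼)).card :=
  card_filter_bind_coe _ fun S => a ∈ S ∧ x ∈ convexHull ℝ S

theorem coverNumber_eq_levelCount (hd : 1 ≤ d) {A : Finset 𝔼} {x : 𝔼}
    (hG : IsGeneralPosition d (fun p : 𝔼 => (p, (1 : ℝ))) (x, 1) A) (k : ℕ) :
    coverNumber A k x = levelCount
      (fun T => T.card = d + 1 ∧ InCone (fun p : 𝔼 => (p, (1 : ℝ))) (x, 1) T)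
      (IsBelow (fun p : 𝔼 => (p, (1 : ℝ))) fun p => ‖p‖ ^ 2 + 1) A k := by
  classical
  rw [coverNumber_eq_card]
  unfold levelCount heftySimplices
  refine congrArg Finset.card (Finset.ext fun T => ?_)
  simp only [Finset.mem_filter, Finset.mem_powersetCard, Finset.mem_powerset,
    mem_convexHull_iff_inCone]
  have key (hTA : T ⊆ A) (hT : T.card = d + 1) :=
    exists_sphere_iff_card_isBelow (U := T) (v := fun p : 𝔼 => (p, (1 : ℝ)))
      (w := fun p => ‖p‖ ^ 2 + 1) finrank_euclidean_prod hT
      (by omega) (hG.linearIndependent T hTA hT)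
      (fun g hg => by
        obtain ⟨c, ρ, h⟩ := exists_center_of_linearForm g
        refine ⟨c, ρ, h, fun p hp => ?_⟩
        linarith [h p, hg p hp])
      (fun c ρ hc => by
        obtain ⟨g, h⟩ := exists_linearForm_of_center c ρ
        refine ⟨g, h, fun p hp => ?_⟩
        linarith [h p, hc p hp]) A k
  constructor
  · rintro ⟨⟨⟨hTA, hT⟩, hs⟩, hc⟩
    exact ⟨hTA, ⟨hT, hc⟩, (key hTA hT).1 hs⟩
  · rintro ⟨hTA, ⟨hT, hc⟩, hk⟩
    exact ⟨⟨⟨hTA, hT⟩, (key hTA hT).2 hk⟩, hc⟩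

/-- Separation: a point outside the hull of `A \ F` is cut off by a half-space missing only points
of `F`. Conversely, take for `F` the points that a half-space misses. -/
theorem mem_kHull_iff (hd : 1 ≤ d) {A : Finset 𝔼} {k : ℕ} {x : 𝔼} :
    x ∈ kHull k A ↔
      ∀ F ⊆ A, F.card ≤ k → x ∈ convexHull ℝ ((A : Set 𝔼) \ (F : Set 𝔼)) := by
  classical
  constructor
  · intro hx F hFA hF
    by_contra hcon
    obtain ⟨u, t, hu, hle, hlt⟩ : ∃ (u : 𝔼) (t : ℝ), u ≠ 0 ∧ (∀ p ∈ A, p ∉ F → ⟪u, p⟫ ≤ t) ∧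
        t < ⟪u, x⟫ := by
      rcases (A \ F).eq_empty_or_nonempty with h | ⟨q, hq⟩
      · have : Nontrivial 𝔼 := by
          have : Nonempty (Fin d) := ⟨⟨0, hd⟩⟩
          infer_instance
        obtain ⟨u, hu⟩ := exists_ne (0 : 𝔼)
        refine ⟨u, ⟪u, x⟫ - 1, hu, fun p hp hpF => ?_, by linarith⟩
        have := Finset.mem_sdiff.2 ⟨hp, hpF⟩
        rw [h] at this
        exact absurd this (Finset.notMem_empty p)
      · have hcl : IsClosed (convexHull ℝ ((A : Set 𝔼) \ (F : Set 𝔼))) :=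
          (A.finite_toSet.subset Set.sdiff_subset).isClosed_convexHull ℝ
        obtain ⟨f, t, hf, hft⟩ := geometric_hahn_banach_closed_point (convex_convexHull ℝ _) hcl hcon
        obtain ⟨u, hu⟩ := exists_inner_eq (f : 𝔼 →ₗ[ℝ] ℝ)
        have hu' : ∀ y, f y = ⟪u, y⟫ := hu
        have hin : ∀ p ∈ A, p ∉ F → ⟪u, p⟫ ≤ t := fun p hp hpF => by
          rw [← hu']
          exact (hf p (subset_convexHull ℝ _ ⟨hp, hpF⟩)).le
        refine ⟨u, t, ?_, hin, by rw [← hu']; exact hft⟩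
        rintro rfl
        rw [Finset.mem_sdiff] at hq
        have h1 := hin q hq.1 hq.2
        have h2 := hft
        rw [hu'] at h2
        rw [inner_zero_left] at h1 h2
        linarith
    have hmem := hx u t hu (le_trans (Finset.card_le_card fun p hp => by
      rw [Finset.mem_filter] at hp
      by_contra hpF
      exact hp.2 (hle p hp.1 hpF)) hF)
    exact absurd hmem (not_le.2 hlt)
  · intro h u t _ hk
    have hx := h (A.filter fun p => p ∉ closedHalfSpace u t) (Finset.filter_subset _ _)
      (by convert hk)
    refine convexHull_min ?_ (convex_halfSpace_le (innerₗ 𝔼 u).isLinear t) hx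
    rintro p ⟨hp, hpF⟩
    by_contra hcon
    exact hpF (Finset.mem_coe.2 (Finset.mem_filter.2 ⟨hp, hcon⟩))

/-- Carathéodory's theorem; general position excludes fewer than `d + 1` vertices. -/
theorem mem_convexHull_sdiff_iff [DecidableEq 𝔼] {A F : Finset 𝔼} {x : 𝔼}
    (hG : IsGeneralPosition d (fun p : 𝔼 => (p, (1 : ℝ))) (x, 1) A) :
    x ∈ convexHull ℝ ((A : Set 𝔼) \ (F : Set 𝔼)) ↔
      ∃ T ⊆ A \ F, T.card = d + 1 ∧ InCone (fun p : 𝔼 => (p, (1 : ℝ))) (x, 1) T := by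
  rw [← Finset.coe_sdiff]
  constructor
  · intro hx
    rw [convexHull_eq_union] at hx
    simp only [Set.mem_iUnion] at hx
    obtain ⟨T, hTs, hind, hxT⟩ := hx
    have hTs' : T ⊆ A \ F := by exact_mod_cast hTs
    refine ⟨T, hTs', le_antisymm ?_ ?_, mem_convexHull_iff_inCone.1 hxT⟩
    · have := hind.card_le_finrank_succ
      rw [Fintype.card_coe] at this
      have h2 := Submodule.finrank_le (vectorSpan ℝ (Set.range ((↑) : T → 𝔼)))
      rw [finrank_euclideanSpace_fin] at h2
      omega
    · by_contra hlt
      exact hG.not_inCone T (hTs'.trans Finset.sdiff_subset) (not_le.1 hlt)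
        (mem_convexHull_iff_inCone.1 hxT)
  · rintro ⟨T, hT, -, hc⟩
    exact convexHull_mono (by exact_mod_cast hT) (mem_convexHull_iff_inCone.2 hc)

theorem coverNumber_eq_zero {A : Finset 𝔼} (hA : A.card < d + 1) (k : ℕ) (x : 𝔼) :
    coverNumber A k x = 0 := by
  rw [coverNumber_eq_card]
  unfold heftySimplices
  rw [Finset.powersetCard_eq_empty.2 hA]
  simp

theorem incidentCoverNumber_eq_zero {A : Finset 𝔼} (hA : A.card < d + 1) (k : ℕ) (a x : 𝔼) :
    incidentCoverNumber A k a x = 0 := by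
  rw [incidentCoverNumber_eq_card]
  unfold heftySimplices
  rw [Finset.powersetCard_eq_empty.2 hA]
  simp

end Affine

/-! ### Part (2): simplices incident to a point. -/

section Star

variable {n : ℕ}

local notation "𝔼" => EuclideanSpace ℝ (Fin (n + 1))

theorem exists_orthogonal_of_span_ne_top {a : 𝔼} {T : Finset 𝔼}
    (h : Submodule.span ℝ (Set.range fun p : T => (p : 𝔼) - a) ≠ ⊤) :
    ∃ u : 𝔼, u ≠ 0 ∧ (∀ p ∈ T, ⟪u, p⟫ = ⟪u, a⟫) ∧
      ∀ x : 𝔼, InCone (fun p : 𝔼 => p - a) (x - a) T → ⟪u, x⟫ = ⟪u, a⟫ := by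
  obtain ⟨f, hf, hle⟩ := Submodule.exists_le_ker_of_lt_top _ h.lt_top
  obtain ⟨u, hu⟩ := exists_inner_eq f
  have hfT : ∀ p ∈ T, f (p - a) = 0 := fun p hp =>
    LinearMap.mem_ker.1 (hle (Submodule.subset_span ⟨⟨p, hp⟩, rfl⟩))
  refine ⟨u, ?_, fun p hp => ?_, ?_⟩
  · rintro rfl
    exact hf (LinearMap.ext fun y => by rw [hu, inner_zero_left, LinearMap.zero_apply])
  · rw [← sub_eq_zero, ← inner_sub_right, ← hu, hfT p hp]
  · rintro x ⟨μ, -, hx⟩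
    rw [← sub_eq_zero, ← inner_sub_right, ← hu, ← hx, map_sum]
    exact Finset.sum_eq_zero fun p hp => by rw [map_smul, hfT p hp, smul_zero]

theorem IsGenericWrt.isGeneralPosition_sub {A : Finset 𝔼} (hcard : n + 2 ≤ A.card)
    (hA : IsGeneric (A : Set 𝔼)) {x : 𝔼} (hx : IsGenericWrt (A : Set 𝔼) x) {a : 𝔼} (ha : a ∈ A) :
    IsGeneralPosition n (fun p : 𝔼 => p - a) (x - a) (A.erase a) := by
  refine ⟨fun T hTA hT => ?_, fun T hTA hT hcone => ?_⟩
  · obtain ⟨hTA, haT⟩ := Finset.subset_erase.1 hTA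
    refine linearIndependent_of_top_le_span_of_card_eq_finrank ?_ (by simp [hT])
    by_contra h
    obtain ⟨u, hu, hT', -⟩ := exists_orthogonal_of_span_ne_top fun h' => h h'.ge
    refine hA.1 (insert a T) (by exact_mod_cast Finset.insert_subset ha hTA)
      (by rw [Finset.card_insert_of_notMem haT, hT]) ⟨u, ⟪u, a⟫, hu, fun p hp => ?_⟩
    rcases Finset.mem_insert.1 hp with rfl | hp
    · rfl
    · exact hT' p hp
  · obtain ⟨S, hTS, hSA, hS⟩ := Finset.exists_subsuperset_card_eq hTA (Nat.lt_succ_iff.1 hT)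
      (by rw [Finset.card_erase_of_mem ha]; omega)
    obtain ⟨hSA, haS⟩ := Finset.subset_erase.1 hSA
    have hspanS : Submodule.span ℝ (Set.range fun p : S => (p : 𝔼) - a) ≠ ⊤ := by
      intro h
      have := finrank_range_le_card (R := ℝ) fun p : S => (p : 𝔼) - a
      rw [Set.finrank, h, finrank_top, finrank_euclideanSpace_fin, Fintype.card_coe] at this
      omega
    obtain ⟨u, hu, hSu, hxu⟩ := exists_orthogonal_of_span_ne_top hspanS
    have haxS : x ∉ insert a S := fun h => hx.1 (Finset.insert_subset ha hSA h)
    refine hx.2.1 (insert x (insert a S)) ?_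
      (by rw [Finset.card_insert_of_notMem haxS, Finset.card_insert_of_notMem haS, hS])
      ⟨u, ⟪u, a⟫, hu, fun p hp => ?_⟩
    · rw [Finset.coe_insert, Set.insert_eq, Set.union_comm]
      exact Set.union_subset_union_left _ (by exact_mod_cast Finset.insert_subset ha hSA)
    · rcases Finset.mem_insert.1 hp with rfl | hp
      · exact hxu _ (hcone.mono hTS)
      · rcases Finset.mem_insert.1 hp with rfl | hp
        · rfl
        · exact hSu p hp

theorem norm_sub_sq_sub_inner (a c p : 𝔼) :
    ‖p - a‖ ^ 2 - ⟪(2 : ℝ) • (c - a), p - a⟫ = ‖p - c‖ ^ 2 - ‖a - c‖ ^ 2 := by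
  rw [show p - c = (p - a) - (c - a) by abel, norm_sub_sq_real (p - a), real_inner_smul_left,
    real_inner_comm, norm_sub_rev a c]
  ring

/-- With no constant term available, forms correspond to spheres through `a`, which saves one
dimension. -/
theorem exists_center_of_linearForm_sub (a : 𝔼) (g : 𝔼 →ₗ[ℝ] ℝ) :
    ∃ c : 𝔼, ∀ p : 𝔼, ‖p - a‖ ^ 2 - g (p - a) = ‖p - c‖ ^ 2 - ‖a - c‖ ^ 2 := by
  obtain ⟨u, hu⟩ := exists_inner_eq g
  refine ⟨a + (1 / 2 : ℝ) • u, fun p => ?_⟩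
  rw [hu, ← norm_sub_sq_sub_inner, add_sub_cancel_left, smul_smul]
  norm_num

theorem IsGeneric.isGenericHeight_sub {A : Finset 𝔼} (hA : IsGeneric (A : Set 𝔼)) {a : 𝔼}
    (ha : a ∈ A) :
    IsGenericHeight n (fun p : 𝔼 => p - a) (fun p => ‖p - a‖ ^ 2) (A.erase a) := by
  refine ⟨fun p hp => ?_, fun T hTA hT p hp hpT g hg hgp => ?_⟩
  · exact pow_pos (norm_pos_iff.2 (sub_ne_zero.2 (Finset.ne_of_mem_erase hp))) 2
  · obtain ⟨hTA, haT⟩ := Finset.subset_erase.1 hTA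
    obtain ⟨hpa, hp⟩ := Finset.mem_erase.1 hp
    obtain ⟨c, h⟩ := exists_center_of_linearForm_sub a g
    have hpaT : a ∉ insert p T := by
      rw [Finset.mem_insert, not_or]
      exact ⟨hpa.symm, haT⟩
    refine hA.norm_sq_ne (T := insert a (insert p T))
      (by exact_mod_cast Finset.insert_subset ha (Finset.insert_subset hp hTA))
      (by rw [Finset.card_insert_of_notMem hpaT, Finset.card_insert_of_notMem hpT, hT])
      c (‖a - c‖ ^ 2) fun q hq => ?_
    have := h q
    rcases Finset.mem_insert.1 hq with rfl | hq
    · rfl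
    · rcases Finset.mem_insert.1 hq with rfl | hq
      · rw [hgp] at this; linarith
      · rw [hg q hq] at this; linarith

theorem inCone_erase_of_mem_convexHull {T : Finset 𝔼} {a x : 𝔼} (ha : a ∈ T)
    (hx : x ∈ convexHull ℝ (T : Set 𝔼)) : InCone (fun p : 𝔼 => p - a) (x - a) (T.erase a) := by
  obtain ⟨μ, hμ, h1, hsum⟩ := Finset.mem_convexHull'.1 hx
  refine ⟨μ, fun p hp => hμ p (Finset.mem_of_mem_erase hp), ?_⟩
  have : ∑ p ∈ T, μ p • (p - a) = x - a := by
    rw [Finset.sum_congr rfl fun p _ => smul_sub (μ p) p a, Finset.sum_sub_distrib, hsum,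
      ← Finset.sum_smul, h1, one_smul]
  rw [← this, ← Finset.add_sum_erase T _ ha, sub_self, smul_zero, zero_add]

theorem incidentCoverNumber_le_levelCount {A : Finset 𝔼} {a x : 𝔼} (ha : a ∈ A)
    (hG : IsGeneralPosition n (fun p : 𝔼 => p - a) (x - a) (A.erase a)) (k : ℕ) :
    incidentCoverNumber A k a x ≤ levelCount
      (fun T => T.card = n + 1 ∧ InCone (fun p : 𝔼 => p - a) (x - a) T)
      (IsBelow (fun p : 𝔼 => p - a) fun p => ‖p - a‖ ^ 2) (A.erase a) k := by
  classical
  rw [incidentCoverNumber_eq_card]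
  unfold levelCount heftySimplices
  refine Finset.card_le_card_of_injOn (fun T => T.erase a) ?_ ?_
  · intro T hT
    simp only [Finset.coe_filter, Finset.mem_filter, Finset.mem_powersetCard, Finset.mem_powerset,
      Set.mem_ofPred_eq] at hT ⊢
    obtain ⟨⟨⟨hTA, hT⟩, c, r, hr, hs, hk⟩, haT, hx⟩ := hT
    have hcard : (T.erase a).card = n + 1 := by rw [Finset.card_erase_of_mem haT, hT]; rfl
    have hTe : T.erase a ⊆ A.erase a := Finset.erase_subset_erase a hTA
    refine ⟨hTe, ⟨hcard, inCone_erase_of_mem_convexHull haT hx⟩, ?_⟩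
    have key := exists_sphere_iff_card_isBelow (U := T) (v := fun p : 𝔼 => p - a)
      (w := fun p => ‖p - a‖ ^ 2) finrank_euclideanSpace_fin hcard (by omega)
      (hG.linearIndependent _ hTe hcard)
      (fun g hg => by
        obtain ⟨c, h⟩ := exists_center_of_linearForm_sub a g
        refine ⟨c, ‖a - c‖ ^ 2, h, fun p hp => ?_⟩
        rcases eq_or_ne p a with rfl | hpa
        · rfl
        · have := h p
          rw [hg p (Finset.mem_erase.2 ⟨hpa, hp⟩)] at this
          linarith)
      (fun c ρ hc => by
        have h : ∀ p, ‖p - a‖ ^ 2 - innerₗ 𝔼 ((2 : ℝ) • (c - a)) (p - a) = ‖p - c‖ ^ 2 - ρ :=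
          fun p => by rw [innerₗ_apply_apply, norm_sub_sq_sub_inner, hc a haT]
        refine ⟨_, h, fun p hp => ?_⟩
        have := h p
        rw [hc p (Finset.mem_of_mem_erase hp)] at this
        linarith) (A.erase a) k
    convert key.1 ⟨c, r, hr, hs, ?_⟩
    -- The vertex `a` lies on the sphere, so erasing it does not change the count inside.
    rw [← hk, Finset.filter_erase, Finset.erase_eq_of_notMem]
    intro h
    exact absurd (Metric.mem_ball.1 (Finset.mem_filter.1 h).2)
      (Metric.mem_sphere.1 (hs a haT)).not_lt
  · intro T hT S hS hTS
    simp only [Finset.coe_filter, Finset.mem_filter, Set.mem_ofPred_eq] at hT hS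
    rw [← Finset.insert_erase hT.2.1, ← Finset.insert_erase hS.2.1]
    exact congrArg (insert a) hTS

theorem incidentCoverNumber_le_choose {A : Finset 𝔼} (hA : IsGeneric (A : Set 𝔼)) {a x : 𝔼}
    (ha : a ∈ A) (hx : IsGenericWrt (A : Set 𝔼) x) (k : ℕ) :
    incidentCoverNumber A k a x ≤ (n + k).choose n := by
  rcases lt_or_ge A.card (n + 2) with hcard | hcard
  · rw [incidentCoverNumber_eq_zero hcard]
    exact Nat.zero_le _
  · have hG := hx.isGeneralPosition_sub hcard hA ha
    exact (incidentCoverNumber_le_levelCount ha hG k).trans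
      (levelCount_isBelow_le_choose finrank_euclideanSpace_fin hG (hA.isGenericHeight_sub ha) k)

end Star

theorem theorem2p4 (d : ℕ) (hd : 1 ≤ d) (A : Finset (EuclideanSpace ℝ (Fin d)))
    (hA : IsGeneric (A : Set (EuclideanSpace ℝ (Fin d)))) (k : ℕ) :
    (∀ x : EuclideanSpace ℝ (Fin d), IsGenericWrt (A : Set (EuclideanSpace ℝ (Fin d))) x →
      coverNumber A k x ≤ (d + k).choose d ∧
      (d ≤ A.card → (coverNumber A k x = (d + k).choose d ↔ x ∈ kHull k A))) ∧
    (∀ a ∈ A, ∃ ε : ℝ, 0 < ε ∧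
      ∀ x : EuclideanSpace ℝ (Fin d), IsGenericWrt (A : Set (EuclideanSpace ℝ (Fin d))) x →
        dist x a < ε → incidentCoverNumber A k a x ≤ (d + k - 1).choose (d - 1)) := by
  constructor
  · intro x hx
    rcases lt_or_ge A.card d with hcard | hcard
    · exact ⟨by rw [coverNumber_eq_zero (by omega)]; exact Nat.zero_le _,
        fun h => absurd hcard (not_lt.2 h)⟩
    · have hG := hx.isGeneralPosition hd hcard hA
      rw [coverNumber_eq_levelCount hd hG]
      refine ⟨levelCount_isBelow_le_choose finrank_euclidean_prod hG hA.isGenericHeight k,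
        fun _ => ?_⟩
      rw [levelCount_isBelow_eq_choose_iff finrank_euclidean_prod hG hA.isGenericHeight,
        mem_kHull_iff hd]
      refine forall₃_congr fun F _ _ => ?_
      rw [mem_convexHull_sdiff_iff hG]
      convert Iff.rfl
  · intro a ha
    -- Any radius works: a simplex at `a` lies in its cone from `a`, so the cone count bounds the
    -- covers of every generic `x`, near `a` or not.
    refine ⟨1, one_pos, fun x hx _ => ?_⟩
    obtain ⟨n, rfl⟩ : ∃ n, d = n + 1 := ⟨d - 1, by omega⟩
    have h := incidentCoverNumber_le_choose hA ha hx k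
    rwa [show n + 1 + k - 1 = n + k by omega, Nat.add_sub_cancel]
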